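/- Work in Cantor space $2^\omega$ with the fair-coin measure $\mu$. For $\sigma\in 2^{<\omega}$ let $[\sigma]$ be the set of all $X\in 2^\omega$ extending $\sigma$; the basic open sets are the sets $[\sigma]$ and $\varnothing$. A sequence of functions $f_n\colon 2^\omega\to[0,\infty)$ is a uniformly computable sequence of total computable functions if a single oracle algorithm, given $n$, $k$ and the oracle $X$, halts for all $n,k,X$ and outputs a dyadic rational within $2^{-k}$ of $f_n(X)$. A function $t\colon 2^\omega\to[0,\infty]$ is lower semicomputable if $t=\sum_n g_n$ for some uniformly computable sequence $\langle g_n\rangle$ of total computable functions $g_n\colon 2^\omega\to[0,\infty)$. A Schnorr test is a sequence $\langle U_n\rangle$ of subsets of $2^\omega$ such that $U_n=\bigcup_s C_{n,s}$ for a computable double sequence $\langle C_{n,s}\rangle$ of basic open sets, $\mu(U_n)\le 2^{-n}$ for all $n$, and the reals $\mu(U_n)$ are computable uniformly in $n$. A point $A\in 2^\omega$ is Schnorr random if $A\notin\bigcap_n U_n$ for every Schnorr test $\langle U_n\rangle$. **Lemma (Key lemma).** Let $t\colon 2^\omega\to[0,\infty]$ be a lower semicomputable function whose integral $\int t\,d\mu$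 is a (finite) computable real number. Then there is a uniformly computable sequence $\langle h_n\rangle$ of total computable functions $h_n\colon 2^\omega\to[0,\infty)$ such that $h_n(X)\le t(X)$ for all $n$ and all $X\in 2^\omega$, and such that for every Schnorr random $A\in 2^\omega$ there is some $n$ with $h_n(A)=t(A)$. -/

import Mathlib

open MeasureTheory
open scoped NNReal ENNReal

namespace Schnorr

/-- Cantor space `2^ω`, with its product topology and product σ-algebra. -/
abbrev Cantor : Type := ℕ → Bool

/-- The fair-coin measure on `2^ω`: the countable product of the uniform measure on `{0, 1}`. -/
noncomputable def coin : Measure Cantor :=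
  Measure.infinitePi fun _ : ℕ => (PMF.uniformOfFintype Bool).toMeasure

/-- The initial segment `X(0) X(1) … X(n-1)` of `X`. -/
def initSeg (X : Cantor) (n : ℕ) : List Bool := (List.range n).map X

/-- The basic open set `[σ]` of all `X` that extend the finite string `σ`. -/
def basicCyl (σ : List Bool) : Set Cantor := {X | initSeg X σ.length = σ}

/-- The basic open sets: the cylinders and (coded by `none`) the empty set. -/
def basicOpen : Option (List Bool) → Set Cantor
  | none => ∅
  | some σ => basicCyl σ

/-- `q` is (the numerator of) a dyadic approximation of precision `k` to `x`:
`|x - q / 2^k| ≤ 2^(-k)`. -/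
def DyadicApprox (x : ℝ≥0) (k q : ℕ) : Prop :=
  |(x : ℝ) - (q : ℝ) / 2 ^ k| ≤ (2 ^ k)⁻¹

/-- A computable nonnegative real number. -/
def ComputableNNReal (x : ℝ≥0) : Prop :=
  ∃ a : ℕ → ℕ, Computable a ∧ ∀ k, DyadicApprox x k (a k)

/-- A uniformly computable sequence of nonnegative real numbers. -/
def UniformlyComputableNNReal (x : ℕ → ℝ≥0) : Prop :=
  ∃ a : ℕ → ℕ → ℕ, Computable₂ a ∧ ∀ n k, DyadicApprox (x n) k (a n k)

/-- A uniformly computable sequence of total computable functions `f n : 2^ω → [0, ∞)`: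
there is a single algorithm (a Turing functional, given by a partial computable function `Φ` on
finite pieces of the oracle) that from `n`, a precision `k` and oracle `X` produces a dyadic
approximation of precision `k` to `f n X`. For every oracle the algorithm halts after reading some
finite initial segment, and an output produced after reading `σ` only is correct for every
oracle that extends `σ`. -/
def UniformlyComputableFun (f : ℕ → Cantor → ℝ≥0) : Prop :=
  ∃ Φ : (ℕ × ℕ) × List Bool →. ℕ, Partrec Φ ∧
    (∀ n k X, ∃ m, (Φ ((n, k), initSeg X m)).Dom) ∧
    (∀ n k σ q, q ∈ Φ ((n, k), σ) → ∀ X ∈ basicCyl σ, DyadicApprox (f n X) k q)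

/-- `t : 2^ω → [0, ∞]` is lower semicomputable: it is the sum of a uniformly computable sequence
of total computable functions with values in `[0, ∞)`. -/
def LowerSemicomputable (t : Cantor → ℝ≥0∞) : Prop :=
  ∃ g : ℕ → Cantor → ℝ≥0, UniformlyComputableFun g ∧ ∀ X, t X = ∑' n, (g n X : ℝ≥0∞)

/-- A uniform sequence of effectively open (`Σ⁰₁`) subsets of `2^ω`. -/
def UniformlySigma01 (U : ℕ → Set Cantor) : Prop :=
  ∃ C : ℕ → ℕ → Option (List Bool), Computable₂ C ∧ ∀ n, U n = ⋃ s, basicOpen (C n s)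

/-- A Martin-Löf test. -/
def IsMartinLofTest (U : ℕ → Set Cantor) : Prop :=
  UniformlySigma01 U ∧ ∀ n, coin (U n) ≤ ((2 : ℝ≥0∞) ^ n)⁻¹

/-- A Schnorr test: a Martin-Löf test whose measures `μ (U n)` are uniformly computable. -/
def IsSchnorrTest (U : ℕ → Set Cantor) : Prop :=
  IsMartinLofTest U ∧ UniformlyComputableNNReal fun n => (coin (U n)).toNNReal

/-- `A` is Schnorr random if it is covered by no Schnorr test. -/
def SchnorrRandom (A : Cantor) : Prop :=
  ∀ U : ℕ → Set Cantor, IsSchnorrTest U → A ∉ ⋂ n, U n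

end Schnorr

/-!
Dovetailing over outputs of the algorithm for `t` gives computable step functions `s k` that
increase to `t`, and the computability of `∫ t` lets us thin them out until
`∫ t - ∫ s k ≤ 4 ^ (-k)`. Put `h n = inf_{k ≥ n} (s k + 2 * 2 ^ (-k))`. Then `h n ≤ t` because
`s k → t`, and since `s` is increasing, the terms up to `k` already determine `h n` up to
`2 * 2 ^ (-k)`, so `h n` is computable. The terms `s k + 2 * 2 ^ (-k)` decrease from `n` on, and
hence `h n = t`, at every point where no jump `s (k + 1) > s k + 2 ^ (-k)` happens for `k ≥ n`.
The jump sets are clopen and by Markov's inequality have measure at most `2 ^ (-k)`, so by the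
effective Borel–Cantelli lemma a Schnorr random point lies in only finitely many of them.
-/

namespace Schnorr

open Filter Topology

section Computability

variable {α β : Type*} [Primcodable α] [Primcodable β]

attribute [fun_prop] Computable Computable.id Computable.const Computable.comp Computable.pair
  Computable.fst Computable.snd Computable.option_getD Computable.list_length
  Computable.option_some Computable.encode

@[fun_prop]
theorem computable_nat_add {f g : α → ℕ} (hf : Computable f) (hg : Computable g) :
    Computable fun a => f a + g a :=
  Primrec.nat_add.to_comp.comp hf hg

@[fun_prop]
theorem computable_nat_sub {f g : α → ℕ} (hf : Computable f) (hg : Computable g) :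
    Computable fun a => f a - g a :=
  Primrec.nat_sub.to_comp.comp hf hg

@[fun_prop]
theorem computable_nat_mul {f g : α → ℕ} (hf : Computable f) (hg : Computable g) :
    Computable fun a => f a * g a :=
  Primrec.nat_mul.to_comp.comp hf hg

@[fun_prop]
theorem computable_nat_div {f g : α → ℕ} (hf : Computable f) (hg : Computable g) :
    Computable fun a => f a / g a :=
  Primrec.nat_div.to_comp.comp hf hg

@[fun_prop]
theorem computable_nat_pow {f g : α → ℕ} (hf : Computable f) (hg : Computable g) :
    Computable fun a => f a ^ g a :=
  (Primrec₂.unpaired'.1 Nat.Primrec.pow).to_comp.comp hf hg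

@[fun_prop]
theorem computable_nat_max {f g : α → ℕ} (hf : Computable f) (hg : Computable g) :
    Computable fun a => max (f a) (g a) :=
  Primrec.nat_max.to_comp.comp hf hg

@[fun_prop]
theorem computable_nat_min {f g : α → ℕ} (hf : Computable f) (hg : Computable g) :
    Computable fun a => min (f a) (g a) :=
  Primrec.nat_min.to_comp.comp hf hg

@[fun_prop]
theorem computable_list_take {f : α → ℕ} {l : α → List β} (hf : Computable f)
    (hl : Computable l) : Computable fun a => (l a).take (f a) :=
  Primrec.list_take.to_comp.comp hf hl

@[fun_prop]
theorem computable_decide_le {f g : α → ℕ} (hf : Computable f) (hg : Computable g) :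
    Computable fun a => decide (f a ≤ g a) :=
  (PrimrecRel.decide Primrec.nat_le).to_comp.comp hf hg

@[fun_prop]
theorem computable_ite_le {f g : α → ℕ} {u v : α → β} (hf : Computable f) (hg : Computable g)
    (hu : Computable u) (hv : Computable v) :
    Computable fun a => if f a ≤ g a then u a else v a :=
  (Computable.cond (computable_decide_le hf hg) hu hv).of_eq fun a => by
    by_cases h : f a ≤ g a <;> simp [h]

@[fun_prop]
theorem computable_evaln (c : Nat.Partrec.Code) {f g : α → ℕ} (hf : Computable f)
    (hg : Computable g) : Computable fun a => Nat.Partrec.Code.evaln (f a) c (g a) :=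
  Nat.Partrec.Code.primrec_evaln.to_comp.comp
    (g := fun a => ((f a, c), g a)) (by fun_prop)

@[fun_prop]
theorem computable_sum_range {f : α → ℕ → ℕ} {g : α → ℕ}
    (hf : Computable fun p : α × ℕ => f p.1 p.2) (hg : Computable g) :
    Computable fun a => ∑ i ∈ Finset.range (g a), f a i := by
  have hstep : Computable₂ fun (a : α) (p : ℕ × ℕ) => p.2 + f a p.1 :=
    computable_nat_add (Computable.snd.comp Computable.snd)
      (hf.comp (g := fun q : α × ℕ × ℕ => (q.1, q.2.1)) (by fun_prop))
  refine (Computable.nat_rec hg (Computable.const 0) hstep).of_eq fun a => ?_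
  induction g a with
  | zero => rfl
  | succ n ih => rw [Finset.sum_range_succ, ← ih]

theorem exists_computable_search {p : α × ℕ → Bool} (hp : Computable p)
    (h : ∀ a, ∃ n, p (a, n) = true) :
    ∃ f : α → ℕ, Computable f ∧ ∀ a, p (a, f a) = true := by
  have hmem : ∀ a, ∃ n, n ∈ Nat.rfind fun n => Part.some (p (a, n)) := fun a =>
    let ⟨_, hn⟩ := h a
    let ⟨m, hm, _⟩ := Nat.rfind_min' (p := fun n => p (a, n)) hn
    ⟨m, hm⟩
  choose f hf using hmem
  exact ⟨f, (Partrec.rfind hp.partrec.to₂).of_eq_tot hf, fun a => by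
    simpa using Nat.rfind_spec (hf a)⟩

theorem exists_computable_strictMono_ge {m : ℕ → ℕ} (hm : Computable m) :
    ∃ M : ℕ → ℕ, Computable M ∧ StrictMono M ∧ ∀ k, m k ≤ M k := by
  refine ⟨fun k => ∑ i ∈ Finset.range (k + 1), (m i + 1), by fun_prop,
    strictMono_nat_of_lt_succ fun k => ?_, fun k => ?_⟩
  · simp only [Finset.sum_range_succ _ (k + 1)]
    omega
  · exact (Nat.le_succ _).trans
      (Finset.single_le_sum (f := fun i => m i + 1) (fun _ _ => Nat.zero_le _)
        (Finset.self_mem_range_succ k))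

end Computability

theorem length_initSeg (X : Cantor) (n : ℕ) : (initSeg X n).length = n := by
  simp [initSeg]

theorem take_initSeg (X : Cantor) {m n : ℕ} (h : m ≤ n) :
    (initSeg X n).take m = initSeg X m := by
  simp [initSeg, ← List.map_take, List.take_range, h]

theorem mem_basicCyl_initSeg (X : Cantor) (n : ℕ) : X ∈ basicCyl (initSeg X n) := by
  simp [basicCyl, length_initSeg]

theorem basicCyl_eq_pi (σ : List Bool) :
    basicCyl σ = Set.pi (Finset.range σ.length) fun i => {σ.getD i false} := by
  ext X
  simp only [basicCyl, Set.mem_ofPred_eq, List.ext_getElem_iff, length_initSeg, true_and,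
    Set.mem_pi, Finset.coe_range, Set.mem_Iio, Set.mem_singleton_iff]
  refine forall_congr' fun i => forall_congr' fun hi => ?_
  simp [initSeg, hi]

theorem measurableSet_basicCyl (σ : List Bool) : MeasurableSet (basicCyl σ) := by
  rw [basicCyl_eq_pi]
  exact MeasurableSet.pi (Finset.countable_toSet _) fun _ _ => MeasurableSet.singleton _

instance : IsProbabilityMeasure coin := by
  unfold coin; infer_instance

theorem coin_basicCyl (σ : List Bool) : coin (basicCyl σ) = (2 ^ σ.length)⁻¹ := by
  rw [basicCyl_eq_pi, coin, Measure.infinitePi_pi _ fun _ _ => MeasurableSet.singleton _]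
  simp [ENNReal.inv_pow]

/-- The binary strings of length `m`, listed so that sums over them can be computed. -/
def strings : ℕ → List (List Bool)
  | 0 => [[]]
  | m + 1 => (strings m).flatMap fun σ => [false :: σ, true :: σ]

theorem mem_strings {m : ℕ} {σ : List Bool} : σ ∈ strings m ↔ σ.length = m := by
  induction m generalizing σ with
  | zero => simp [strings]
  | succ m ih => rcases σ with _ | ⟨_ | _, σ⟩ <;> simp [strings, ih]

theorem nodup_strings (m : ℕ) : (strings m).Nodup := by
  induction m with
  | zero => simp [strings]
  | succ m ih =>
    rw [strings, List.nodup_flatMap]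
    refine ⟨fun σ _ => by simp, ih.imp fun {σ τ} h => ?_⟩
    simp [Function.onFun, Ne.symm h]

theorem computable_strings : Computable strings := by
  have hcons (b : Bool) : Primrec fun p : (ℕ × List (List Bool)) × List Bool => b :: p.2 :=
    Primrec.list_cons.comp (Primrec.const b) Primrec.snd
  have hstep : Primrec₂ fun (_ : ℕ) (l : List (List Bool)) =>
      l.flatMap fun σ => [false :: σ, true :: σ] :=
    Primrec.list_flatMap Primrec.snd <| Primrec.list_cons.comp (hcons false) <|
      Primrec.list_cons.comp (hcons true) (Primrec.const [])
  refine (Primrec.nat_rec₁ [[]] hstep).to_comp.of_eq fun m => ?_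
  induction m with
  | zero => rfl
  | succ m ih => rw [strings, ← ih]

@[fun_prop]
theorem computable_sum_strings {α : Type*} [Primcodable α] {f : α × List Bool → ℕ} {g : α → ℕ}
    (hf : Computable f) (hg : Computable g) :
    Computable fun a => ∑ σ ∈ (strings (g a)).toFinset, f (a, σ) := by
  have hs : Computable fun a => strings (g a) := computable_strings.comp hg
  have hget : Computable fun p : α × ℕ => (strings (g p.1)).getD p.2 [] :=
    (Primrec.list_getD []).to_comp.comp (hs.comp Computable.fst) Computable.snd
  have hsum : Computable fun a =>
      ∑ i ∈ Finset.range (strings (g a)).length, f (a, (strings (g a)).getD i []) :=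
    computable_sum_range (hf.comp (Computable.fst.pair hget)) (by fun_prop)
  refine hsum.of_eq fun a => ?_
  rw [List.sum_toFinset _ (nodup_strings _), Finset.sum_range, ← Fin.sum_univ_fun_getElem]
  simp

theorem comp_initSeg_eq_sum_indicator {M : Type*} [AddCommMonoid M] (F : List Bool → M) (m : ℕ)
    (X : Cantor) : F (initSeg X m) =
      ∑ σ ∈ (strings m).toFinset, (basicCyl σ).indicator (fun _ => F σ) X := by
  rw [Finset.sum_eq_single (initSeg X m), Set.indicator_of_mem (mem_basicCyl_initSeg X m)]
  · intro σ hσ hne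
    refine Set.indicator_of_notMem (fun hX => hne ?_) _
    rw [← mem_strings.1 (List.mem_toFinset.1 hσ)]
    exact hX.symm
  · exact fun h => absurd (List.mem_toFinset.2 (mem_strings.2 (length_initSeg X m))) h

theorem measurable_comp_initSeg (F : List Bool → ℝ≥0∞) (m : ℕ) :
    Measurable fun X => F (initSeg X m) := by
  simp only [comp_initSeg_eq_sum_indicator F m]
  exact Finset.measurable_fun_sum _ fun σ _ =>
    measurable_const.indicator (measurableSet_basicCyl σ)

theorem lintegral_comp_initSeg (F : List Bool → ℝ≥0∞) (m : ℕ) :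
    ∫⁻ X, F (initSeg X m) ∂coin = (∑ σ ∈ (strings m).toFinset, F σ) / 2 ^ m := by
  simp only [comp_initSeg_eq_sum_indicator F m]
  rw [lintegral_finsetSum _ fun σ _ => measurable_const.indicator (measurableSet_basicCyl σ),
    div_eq_mul_inv, Finset.sum_mul]
  refine Finset.sum_congr rfl fun σ hσ => ?_
  rw [lintegral_indicator_const (measurableSet_basicCyl σ), coin_basicCyl,
    mem_strings.1 (List.mem_toFinset.1 hσ)]

section Step

variable {α β : Type*} [Primcodable α] [Primcodable β]

/-- A uniformly computable family of dyadic step functions: from the level `L a` on, the initial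
segment of `X` of length `l` determines the numerator, over `2 ^ l`, of `φ a X`. Asking for a
numerator at every such level lets families of different levels be combined pointwise. -/
def UniformlyStep (φ : α → Cantor → ℝ≥0) : Prop :=
  ∃ (L : α → ℕ) (N : α × List Bool → ℕ), Computable L ∧ Computable N ∧
    ∀ a l, L a ≤ l → ∀ X, φ a X = N (a, initSeg X l) / 2 ^ l

namespace UniformlyStep

variable {φ ψ : α → Cantor → ℝ≥0}

theorem of_initSeg {L D : α → ℕ} {N : α × List Bool → ℕ} (hL : Computable L) (hD : Computable D)
    (hN : Computable N) :
    UniformlyStep fun a X => (N (a, initSeg X (L a)) / 2 ^ D a : ℝ≥0) := by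
  refine ⟨fun a => max (L a) (D a),
    fun p => N (p.1, p.2.take (L p.1)) * 2 ^ (p.2.length - D p.1), by fun_prop, by fun_prop,
    fun a l hl X => ?_⟩
  simp only [take_initSeg X (le_of_max_le_left hl), length_initSeg]
  rw [div_eq_div_iff (by positivity) (by positivity)]
  push_cast
  rw [mul_assoc, pow_sub_mul_pow _ (le_of_max_le_right hl)]

theorem const {c D : α → ℕ} (hc : Computable c) (hD : Computable D) :
    UniformlyStep fun a _ => (c a / 2 ^ D a : ℝ≥0) :=
  of_initSeg (L := fun _ => 0) (N := fun p => c p.1) (by fun_prop) hD (by fun_prop)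

theorem comp (hφ : UniformlyStep φ) {g : β → α} (hg : Computable g) :
    UniformlyStep fun b => φ (g b) := by
  obtain ⟨L, N, hL, hN, h⟩ := hφ
  exact ⟨fun b => L (g b), fun p => N (g p.1, p.2), by fun_prop, by fun_prop,
    fun b => h (g b)⟩

theorem add (hφ : UniformlyStep φ) (hψ : UniformlyStep ψ) :
    UniformlyStep fun a X => φ a X + ψ a X := by
  obtain ⟨L, N, hL, hN, h⟩ := hφ
  obtain ⟨L', N', hL', hN', h'⟩ := hψ
  refine ⟨fun a => max (L a) (L' a), fun p => N p + N' p, by fun_prop, by fun_prop,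
    fun a l hl X => ?_⟩
  simp only [h a l (le_of_max_le_left hl), h' a l (le_of_max_le_right hl), Nat.cast_add, add_div]

theorem iterate {φ : α × ℕ → Cantor → ℝ≥0} (hφ : UniformlyStep φ) {op : ℝ≥0 → ℝ≥0 → ℝ≥0}
    {opNum : ℕ × ℕ → ℕ} (hopNum : Computable opNum)
    (hop : ∀ x y l : ℕ, op (x / 2 ^ l) (y / 2 ^ l) = opNum (x, y) / 2 ^ l)
    {ψ : α × ℕ → Cantor → ℝ≥0} (hzero : ∀ a X, ψ (a, 0) X = φ (a, 0) X)
    (hsucc : ∀ a i X, ψ (a, i + 1) X = op (ψ (a, i) X) (φ (a, i + 1) X)) :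
    UniformlyStep ψ := by
  obtain ⟨L, N, hL, hN, h⟩ := hφ
  let F (q : (α × ℕ) × List Bool) : ℕ :=
    Nat.rec (N ((q.1.1, 0), q.2)) (fun i y => opNum (y, N ((q.1.1, i + 1), q.2))) q.1.2
  have hF : Computable F :=
    Computable.nat_rec (f := fun q : (α × ℕ) × List Bool => q.1.2)
      (g := fun q => N ((q.1.1, 0), q.2))
      (h := fun q p => opNum (p.2, N ((q.1.1, p.1 + 1), q.2)))
      (by fun_prop) (by fun_prop) (Computable₂.mk (by fun_prop))
  refine ⟨fun p => ∑ i ∈ Finset.range (p.2 + 1), L (p.1, i), F, by fun_prop, hF,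
    fun ⟨a, j⟩ l => ?_⟩
  induction j with
  | zero => simpa [hzero, F] using h (a, 0) l
  | succ j ih =>
    intro hl X
    simp only [Finset.sum_range_succ _ (j + 1)] at hl
    rw [hsucc, ih (le_of_add_le_left hl), h (a, j + 1) l (le_of_add_le_right hl), hop]

theorem sum {φ : α × ℕ → Cantor → ℝ≥0} (hφ : UniformlyStep φ) :
    UniformlyStep fun (p : α × ℕ) X => ∑ i ∈ Finset.range (p.2 + 1), φ (p.1, i) X :=
  hφ.iterate (op := (· + ·)) (opNum := fun p => p.1 + p.2) (by fun_prop)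
    (fun x y l => by push_cast; rw [add_div]) (fun a X => by simp)
    fun a i X => Finset.sum_range_succ _ _

theorem diagonalSum {φ : ℕ × ℕ → Cantor → ℝ≥0} (hφ : UniformlyStep φ) :
    UniformlyStep fun m X => ∑ n ∈ Finset.range (m + 1), φ (n, m) X :=
  have hswap : UniformlyStep fun p : ℕ × ℕ => φ (p.2, p.1) := hφ.comp (by fun_prop)
  hswap.sum.comp (g := fun m => (m, m)) (by fun_prop)

theorem partialSups {φ : α × ℕ → Cantor → ℝ≥0} (hφ : UniformlyStep φ) :
    UniformlyStep fun (p : α × ℕ) X => partialSups (fun i => φ (p.1, i) X) p.2 :=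
  hφ.iterate (op := max) (opNum := fun p => max p.1 p.2) (by fun_prop)
    (fun x y l => by rw [Nat.cast_max, max_div_div_right zero_le]) (fun a X => partialSups_zero _)
    fun a i X => partialSups_add_one _ _

theorem inf' {φ : α × ℕ → Cantor → ℝ≥0} (hφ : UniformlyStep φ) :
    UniformlyStep fun (p : α × ℕ) X =>
      (Finset.range (p.2 + 1)).inf' Finset.nonempty_range_add_one fun i => φ (p.1, i) X :=
  hφ.iterate (op := min) (opNum := fun p => min p.1 p.2) (by fun_prop)
    (fun x y l => by rw [Nat.cast_min, min_div_div_right zero_le]) (fun a X => by simp)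
    fun a i X => by
      simp only [Finset.range_add_one (n := i + 1)]
      rw [Finset.inf'_insert Finset.nonempty_range_add_one, inf_comm]

theorem measurable (hφ : UniformlyStep φ) (a : α) :
    Measurable fun X => (φ a X : ℝ≥0∞) := by
  obtain ⟨L, N, -, -, h⟩ := hφ
  simp only [h a _ le_rfl]
  exact measurable_comp_initSeg (fun σ => ((N (a, σ) / 2 ^ L a : ℝ≥0) : ℝ≥0∞)) (L a)

theorem exists_lintegral_eq (hφ : UniformlyStep φ) :
    ∃ c D : α → ℕ, Computable c ∧ Computable D ∧
      ∀ a, ∫⁻ X, φ a X ∂coin = ((c a / 2 ^ D a : ℝ≥0) : ℝ≥0∞) := by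
  obtain ⟨L, N, hL, hN, h⟩ := hφ
  refine ⟨fun a => ∑ σ ∈ (strings (L a)).toFinset, N (a, σ), fun a => L a + L a,
    by fun_prop, by fun_prop, fun a => ?_⟩
  simp only [h a _ le_rfl]
  rw [lintegral_comp_initSeg fun σ => ((N (a, σ) / 2 ^ L a : ℝ≥0) : ℝ≥0∞),
    ← ENNReal.ofNNReal_finsetSum, ← Finset.sum_div, pow_add, ← div_div,
    ENNReal.coe_div (by positivity)]
  push_cast
  rfl

end UniformlyStep

/-- A uniformly computable family of clopen sets, presented by their indicator functions. -/
def UniformlyClopen (V : α → Set Cantor) : Prop :=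
  UniformlyStep fun a => (V a).indicator 1

theorem UniformlyStep.uniformlyClopen_lt {φ ψ : α → Cantor → ℝ≥0} (hφ : UniformlyStep φ)
    (hψ : UniformlyStep ψ) : UniformlyClopen fun a => {X | φ a X < ψ a X} := by
  obtain ⟨L, N, hL, hN, h⟩ := hφ
  obtain ⟨L', N', hL', hN', h'⟩ := hψ
  refine ⟨fun a => max (L a) (L' a), fun p => if N' p ≤ N p then 0 else 2 ^ p.2.length,
    by fun_prop, by fun_prop, fun a l hl X => ?_⟩
  have hlt : φ a X < ψ a X ↔ ¬N' (a, initSeg X l) ≤ N (a, initSeg X l) := by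
    rw [h a l (le_of_max_le_left hl), h' a l (le_of_max_le_right hl),
      div_lt_div_iff_of_pos_right (by positivity), Nat.cast_lt, not_le]
  simp only [Set.indicator_apply, Set.mem_ofPred_eq, hlt, ite_not, length_initSeg]
  split_ifs <;> simp

namespace UniformlyClopen

variable {V : α → Set Cantor}

theorem comp (hV : UniformlyClopen V) {g : β → α} (hg : Computable g) :
    UniformlyClopen fun b => V (g b) :=
  UniformlyStep.comp hV hg

theorem accumulate {V : α × ℕ → Set Cantor} (hV : UniformlyClopen V) :
    UniformlyClopen fun p : α × ℕ => Set.accumulate (fun i => V (p.1, i)) p.2 :=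
  UniformlyStep.iterate hV (op := max) (opNum := fun p => max p.1 p.2) (by fun_prop)
    (fun x y l => by rw [Nat.cast_max, max_div_div_right zero_le])
    (fun a X => by simp only [Set.accumulate_zero_nat]) fun a i X => by
      simp only [Set.accumulate_succ]
      by_cases h : X ∈ Set.accumulate (fun i => V (a, i)) i <;>
        by_cases h' : X ∈ V (a, i + 1) <;> simp [h, h']

theorem measurableSet (hV : UniformlyClopen V) (a : α) : MeasurableSet (V a) := by
  refine (measurable_indicator_const_iff (1 : ℝ≥0∞)).1 ?_
  convert UniformlyStep.measurable hV a with X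
  by_cases hX : X ∈ V a <;> simp [hX]

theorem exists_coin_eq (hV : UniformlyClopen V) :
    ∃ c D : α → ℕ, Computable c ∧ Computable D ∧
      ∀ a, coin (V a) = ((c a / 2 ^ D a : ℝ≥0) : ℝ≥0∞) := by
  obtain ⟨c, D, hc, hD, h⟩ := UniformlyStep.exists_lintegral_eq hV
  refine ⟨c, D, hc, hD, fun a => ?_⟩
  rw [← h, ← lintegral_indicator_one (hV.measurableSet a)]
  refine lintegral_congr fun X => ?_
  by_cases hX : X ∈ V a <;> simp [hX]

theorem uniformlySigma01_iUnion {V : ℕ × ℕ → Set Cantor} (hV : UniformlyClopen V) :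
    UniformlySigma01 fun n => ⋃ k, V (n, k) := by
  obtain ⟨L, N, hL, hN, h⟩ := hV
  have hmem (p : ℕ × ℕ) (l : ℕ) (hl : L p ≤ l) (X : Cantor) :
      X ∈ V p ↔ 1 ≤ N (p, initSeg X l) := by
    rw [← not_iff_not, ← Set.indicator_eq_zero_iff_notMem ℝ≥0]
    simp [h p l hl X]
  let C (n s : ℕ) : Option (List Bool) :=
    let e := (Encodable.decode (α := ℕ × List Bool) s).getD (0, [])
    if L (n, e.1) ≤ e.2.length then if 1 ≤ N ((n, e.1), e.2) then some e.2 else none else none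
  have hC : Computable fun p : ℕ × ℕ => C p.1 p.2 := by
    have := Computable.decode (α := ℕ × List Bool)
    fun_prop
  refine ⟨C, hC, fun n => Set.ext fun X => ?_⟩
  simp only [Set.mem_iUnion]
  constructor
  · rintro ⟨k, hX⟩
    let σ := initSeg X (L (n, k))
    refine ⟨Encodable.encode (k, σ), ?_⟩
    have hσ : L (n, k) ≤ σ.length := (length_initSeg _ _).ge
    simp only [C, Encodable.encodek, Option.getD_some, hσ, (hmem _ _ le_rfl X).1 hX, σ, if_true]
    exact mem_basicCyl_initSeg X _
  · rintro ⟨s, hX⟩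
    simp only [C] at hX
    split_ifs at hX with hL hN
    · refine ⟨_, (hmem _ _ hL X).2 ?_⟩
      rwa [show initSeg X _ = _ from hX]
    all_goals exact hX.elim

end UniformlyClopen

end Step

/-- The numerator, over `2 ^ k`, of a dyadic rational of denominator `2 ^ k` nearest to
`c / 2 ^ d`. -/
def roundDyadic (c d k : ℕ) : ℕ := (2 * c * 2 ^ k + 2 ^ d) / 2 ^ (d + 1)

theorem abs_div_sub_roundDyadic_le (c d k : ℕ) :
    |(c / 2 ^ d : ℝ) - roundDyadic c d k / 2 ^ k| ≤ (2 ^ (k + 1))⁻¹ := by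
  have hlow : (roundDyadic c d k * 2 ^ (d + 1) : ℝ) ≤ 2 * c * 2 ^ k + 2 ^ d := by
    exact_mod_cast Nat.div_mul_le_self (2 * c * 2 ^ k + 2 ^ d) (2 ^ (d + 1))
  have hhigh : (2 * c * 2 ^ k + 2 ^ d : ℝ) < (roundDyadic c d k + 1) * 2 ^ (d + 1) := by
    exact_mod_cast Nat.lt_mul_of_div_lt (Nat.lt_succ_self _) (by positivity)
  have hdiff : (c / 2 ^ d : ℝ) - roundDyadic c d k / 2 ^ k =
      (c * 2 ^ k - 2 ^ d * roundDyadic c d k) / (2 ^ d * 2 ^ k) :=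
    div_sub_div _ _ (by positivity) (by positivity)
  have hbound : (2 ^ (k + 1) : ℝ)⁻¹ = 2 ^ d / 2 / (2 ^ d * 2 ^ k) := by
    rw [pow_succ]
    field_simp
  rw [hdiff, hbound, abs_div, abs_of_pos (a := (2 ^ d * 2 ^ k : ℝ)) (by positivity)]
  rw [pow_succ] at hlow hhigh
  refine div_le_div_of_nonneg_right (abs_le.2 ⟨?_, ?_⟩) (by positivity) <;> linarith

theorem dyadicApprox_roundDyadic {x : ℝ≥0} {c d k : ℕ}
    (h : |(x : ℝ) - c / 2 ^ d| ≤ (2 ^ (k + 1))⁻¹) : DyadicApprox x k (roundDyadic c d k) :=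
  calc |(x : ℝ) - roundDyadic c d k / 2 ^ k|
    _ ≤ |(x : ℝ) - c / 2 ^ d| + |(c / 2 ^ d : ℝ) - roundDyadic c d k / 2 ^ k| :=
      abs_sub_le _ _ _
    _ ≤ (2 ^ (k + 1))⁻¹ + (2 ^ (k + 1))⁻¹ := add_le_add h (abs_div_sub_roundDyadic_le c d k)
    _ = (2 ^ k)⁻¹ := by rw [pow_succ]; ring

theorem UniformlyComputableNNReal.of_approx {x : ℕ → ℝ≥0} {c d : ℕ × ℕ → ℕ} (hc : Computable c)
    (hd : Computable d)
    (h : ∀ n k, |(x n : ℝ) - c (n, k) / 2 ^ d (n, k)| ≤ (2 ^ (k + 1))⁻¹) :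
    UniformlyComputableNNReal x := by
  refine ⟨fun n k => roundDyadic (c (n, k)) (d (n, k)) k, Computable₂.mk ?_,
    fun n k => dyadicApprox_roundDyadic (h n k)⟩
  simp only [roundDyadic]
  fun_prop

theorem UniformlyComputableFun.of_step {f : ℕ → Cantor → ℝ≥0} {φ : ℕ × ℕ → Cantor → ℝ≥0}
    (hφ : UniformlyStep φ) (h : ∀ n k X, |(f n X : ℝ) - φ (n, k) X| ≤ (2 ^ (k + 1))⁻¹) :
    UniformlyComputableFun f := by
  obtain ⟨L, N, hL, hN, hφN⟩ := hφ
  let Φ (p : (ℕ × ℕ) × List Bool) : Option ℕ :=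
    if L p.1 ≤ p.2.length then some (roundDyadic (N p) p.2.length p.1.2) else none
  have hΦ : Computable Φ := by
    simp only [Φ, roundDyadic]
    fun_prop
  refine ⟨fun p => Φ p, hΦ.ofOption, fun n k X => ⟨L (n, k), ?_⟩, fun n k σ q hq X hX => ?_⟩
  · simp [Φ, length_initSeg]
  · simp only [Φ, Part.mem_ofOption, Option.mem_def, Option.ite_none_right_eq_some,
      Option.some.injEq] at hq
    obtain ⟨hσ, rfl⟩ := hq
    have hX : initSeg X σ.length = σ := hX
    refine dyadicApprox_roundDyadic (le_of_eq_of_le ?_ (h n k X))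
    rw [hφN _ _ hσ X, hX]
    push_cast
    rfl

theorem abs_coe_sub_coe_le {x y ε : ℝ≥0} (hle : y ≤ x) (hge : x ≤ y + ε) :
    |(x : ℝ) - y| ≤ ε := by
  rw [abs_of_nonneg (sub_nonneg.2 (NNReal.coe_le_coe.2 hle)), sub_le_iff_le_add']
  exact_mod_cast hge

theorem ennreal_coe_inv_two_pow (k : ℕ) : (((2 ^ k)⁻¹ : ℝ≥0) : ℝ≥0∞) = (2 ^ k)⁻¹ := by
  rw [ENNReal.coe_inv (by positivity), ENNReal.coe_pow, ENNReal.coe_ofNat]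

theorem ennreal_coe_two_div_two_pow (k : ℕ) : ((2 / 2 ^ k : ℝ≥0) : ℝ≥0∞) = 2 / 2 ^ k := by
  rw [ENNReal.coe_div (by positivity), ENNReal.coe_pow, ENNReal.coe_ofNat]

section BorelCantelli

theorem tsum_inv_two_pow_add (m : ℕ) : ∑' j, ((2 : ℝ≥0∞) ^ (m + 1 + j))⁻¹ = (2 ^ m)⁻¹ := by
  simp only [ENNReal.inv_pow]
  simp only [pow_add _ (m + 1)]
  rw [ENNReal.tsum_mul_left, ENNReal.tsum_geometric, ENNReal.one_sub_inv_two, inv_inv, pow_succ,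
    mul_assoc, ENNReal.inv_mul_cancel two_ne_zero ENNReal.ofNat_ne_top, mul_one]

variable {Ω : Type*} [MeasurableSpace Ω] {μ : Measure Ω}

theorem measure_iUnion_tail_le {V : ℕ → Set Ω} (hV : ∀ k, μ (V k) ≤ (2 ^ k)⁻¹) (m : ℕ) :
    μ (⋃ j, V (m + 1 + j)) ≤ (2 ^ m)⁻¹ :=
  calc μ (⋃ j, V (m + 1 + j))
    _ ≤ ∑' j, μ (V (m + 1 + j)) := measure_iUnion_le _
    _ ≤ ∑' j, (2 ^ (m + 1 + j))⁻¹ := ENNReal.tsum_le_tsum fun _ => hV _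
    _ = (2 ^ m)⁻¹ := tsum_inv_two_pow_add m

theorem iUnion_subset_accumulate_union {α : Type*} (U : ℕ → Set α) (p : ℕ) :
    ⋃ k, U k ⊆ Set.accumulate U p ∪ ⋃ j, U (p + 1 + j) := by
  refine Set.iUnion_subset fun k x hx => ?_
  rcases le_or_gt k p with hk | hk
  · exact Or.inl (Set.mem_accumulate.2 ⟨k, hk, hx⟩)
  · exact Or.inr (Set.mem_iUnion.2 ⟨k - (p + 1), by rwa [Nat.add_sub_cancel' hk]⟩)

theorem measure_iUnion_tail_le_accumulate_add {V : ℕ → Set Ω} (hV : ∀ k, μ (V k) ≤ (2 ^ k)⁻¹)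
    (n p : ℕ) : μ (⋃ k, V (n + 1 + k)) ≤
      μ (Set.accumulate (fun k => V (n + 1 + k)) p) + (2 ^ (p + 1))⁻¹ :=
  calc μ (⋃ k, V (n + 1 + k))
    _ ≤ μ (Set.accumulate (fun k => V (n + 1 + k)) p) + μ (⋃ j, V (n + 1 + (p + 1 + j))) :=
      (measure_mono (iUnion_subset_accumulate_union _ p)).trans (measure_union_le _ _)
    _ = μ (Set.accumulate (fun k => V (n + 1 + k)) p) + μ (⋃ j, V (n + 1 + p + 1 + j)) := by
      simp only [add_assoc]
    _ ≤ μ (Set.accumulate (fun k => V (n + 1 + k)) p) + (2 ^ (n + 1 + p))⁻¹ := by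
      gcongr
      exact measure_iUnion_tail_le hV _
    _ ≤ μ (Set.accumulate (fun k => V (n + 1 + k)) p) + (2 ^ (p + 1))⁻¹ := by
      gcongr (_ + (2 ^ ?_)⁻¹)
      · exact one_le_two
      · omega

theorem abs_toNNReal_sub_le {x : ℝ≥0∞} {y ε : ℝ≥0} (hle : y ≤ x) (hge : x ≤ y + ε) :
    |(x.toNNReal : ℝ) - y| ≤ ε := by
  lift x to ℝ≥0 using ne_top_of_le_ne_top (by simp) hge
  norm_cast at hle hge
  exact abs_coe_sub_coe_le hle hge

theorem isSchnorrTest_iUnion_tail {V : ℕ → Set Cantor} (hV : UniformlyClopen V)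
    (hμ : ∀ k, coin (V k) ≤ (2 ^ k)⁻¹) : IsSchnorrTest fun n => ⋃ k, V (n + 1 + k) := by
  have htail : UniformlyClopen fun p : ℕ × ℕ => V (p.1 + 1 + p.2) := hV.comp (by fun_prop)
  refine ⟨⟨htail.uniformlySigma01_iUnion, measure_iUnion_tail_le hμ⟩, ?_⟩
  obtain ⟨c, D, hc, hD, h⟩ := htail.accumulate.exists_coin_eq
  refine .of_approx hc hD fun n p => ?_
  have hle : coin (Set.accumulate (fun k => V (n + 1 + k)) p) ≤ coin (⋃ k, V (n + 1 + k)) :=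
    measure_mono (Set.accumulate_subset_iUnion p)
  have hge := measure_iUnion_tail_le_accumulate_add hμ n p
  rw [h (n, p)] at hle
  rw [h (n, p), ← ennreal_coe_inv_two_pow] at hge
  exact_mod_cast (abs_toNNReal_sub_le hle hge :)

theorem SchnorrRandom.eventually_notMem {A : Cantor} (hA : SchnorrRandom A) {V : ℕ → Set Cantor}
    (hV : UniformlyClopen V) (hμ : ∀ k, coin (V k) ≤ (2 ^ k)⁻¹) : ∃ n, ∀ k ≥ n, A ∉ V k := by
  obtain ⟨n, hn⟩ : ∃ n, ∀ k, A ∉ V (n + 1 + k) := by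
    simpa using hA _ (isSchnorrTest_iUnion_tail hV hμ)
  refine ⟨n + 1, fun k hk => ?_⟩
  simpa [Nat.add_sub_cancel' hk] using hn (k - (n + 1))

end BorelCantelli

section Approximation

theorem dyadicApprox_iff {x : ℝ≥0} {k q : ℕ} :
    DyadicApprox x k q ↔ x * 2 ^ k ≤ q + 1 ∧ (q : ℝ≥0) ≤ x * 2 ^ k + 1 := by
  have hpos : (0 : ℝ) < 2 ^ k := by positivity
  have hdiff : (x : ℝ) - q / 2 ^ k = (x * 2 ^ k - q) / 2 ^ k := by field_simp
  rw [DyadicApprox, hdiff, abs_div, abs_of_pos hpos, ← one_div, div_le_div_iff_of_pos_right hpos,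
    abs_sub_le_iff, sub_le_iff_le_add', sub_le_iff_le_add']
  exact_mod_cast Iff.rfl

theorem DyadicApprox.pred_div_le {x : ℝ≥0} {k q : ℕ} (h : DyadicApprox x k q) :
    ((q - 1 : ℕ) : ℝ≥0) / 2 ^ k ≤ x := by
  rw [div_le_iff₀ (by positivity), Nat.cast_tsub, Nat.cast_one, tsub_le_iff_right]
  exact (dyadicApprox_iff.1 h).2

theorem DyadicApprox.le_pred_div_add {x : ℝ≥0} {k q : ℕ} (h : DyadicApprox x k q) :
    x ≤ ((q - 1 : ℕ) : ℝ≥0) / 2 ^ k + 2 / 2 ^ k := by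
  rw [← add_div, le_div_iff₀ (by positivity)]
  exact (dyadicApprox_iff.1 h).1.trans (by exact_mod_cast (by omega : q + 1 ≤ q - 1 + 2))

theorem le_of_forall_le_add_two_div_two_pow {x b : ℝ≥0∞} (h : ∀ k : ℕ, x ≤ b + 2 / 2 ^ k) :
    x ≤ b := by
  have hlim : Tendsto (fun k : ℕ => b + 2 * 2⁻¹ ^ k) atTop (𝓝 (b + 2 * 0)) :=
    (ENNReal.Tendsto.const_mul (ENNReal.tendsto_pow_atTop_nhds_zero_of_lt_one
      ENNReal.one_half_lt_one) (Or.inr ENNReal.ofNat_ne_top)).const_add b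
  rw [mul_zero, add_zero] at hlim
  exact ge_of_tendsto' hlim fun k => (h k).trans_eq (by rw [div_eq_mul_inv, ENNReal.inv_pow])

theorem exists_computable_stages {α : Type*} [Primcodable α] {Φ : α →. ℕ} (hΦ : Partrec Φ) :
    ∃ stage : ℕ × α → Option ℕ, Computable stage ∧
      ∀ a q, q ∈ Φ a ↔ ∃ s, stage (s, a) = some q := by
  obtain ⟨c, hc⟩ := Nat.Partrec.Code.exists_code.1 hΦ
  refine ⟨fun p => c.evaln p.1 (Encodable.encode p.2), by fun_prop, fun a q => ?_⟩
  simpa [hc] using Nat.Partrec.Code.evaln_complete (c := c) (n := Encodable.encode a) (x := q)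

theorem UniformlyComputableFun.exists_step_le {g : ℕ → Cantor → ℝ≥0}
    (hg : UniformlyComputableFun g) : ∃ ψ : ℕ × ℕ × ℕ × ℕ → Cantor → ℝ≥0, UniformlyStep ψ ∧
      (∀ n e X, ψ (n, e) X ≤ g n X) ∧ ∀ n k X, ∃ e, g n X ≤ ψ (n, e) X + 2 / 2 ^ k := by
  obtain ⟨Φ, hΦ, hdom, hcorrect⟩ := hg
  obtain ⟨stage, hstage_comp, hstage⟩ := exists_computable_stages hΦ
  -- The index `(n, k, s, l)` stands for precision `k`, `s` steps and oracle use `l`. The numerator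
  -- is lowered by one to give a lower bound; a computation that has not halted yields `0`.
  let ψ (p : ℕ × ℕ × ℕ × ℕ) (X : Cantor) : ℝ≥0 :=
    (((stage (p.2.2.1, ((p.1, p.2.1), initSeg X p.2.2.2))).getD 0 - 1 : ℕ) : ℝ≥0) / 2 ^ p.2.1
  have hψ : UniformlyStep ψ :=
    (UniformlyStep.of_initSeg (L := fun p : ℕ × ℕ × ℕ × ℕ => p.2.2.2) (D := fun p => p.2.1)
      (N := fun p => (stage (p.1.2.2.1, ((p.1.1, p.1.2.1), p.2))).getD 0 - 1)
      (by fun_prop) (by fun_prop) (by fun_prop) :)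
  refine ⟨ψ, hψ, fun n e X => ?_, fun n k X => ?_⟩
  · rcases hs : stage (e.2.1, ((n, e.1), initSeg X e.2.2)) with _ | q
    · simp [ψ, hs]
    · simpa [ψ, hs] using
        (hcorrect n e.1 _ q ((hstage _ q).2 ⟨_, hs⟩) X (mem_basicCyl_initSeg X _)).pred_div_le
  · obtain ⟨l, hl⟩ := hdom n k X
    obtain ⟨q, hq⟩ := Part.dom_iff_mem.1 hl
    obtain ⟨s, hs⟩ := (hstage _ q).1 hq
    refine ⟨(k, s, l), ?_⟩
    simpa [ψ, hs] using
      (hcorrect n k _ q hq X (mem_basicCyl_initSeg X l)).le_pred_div_add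

theorem UniformlyComputableFun.exists_iSup {g : ℕ → Cantor → ℝ≥0}
    (hg : UniformlyComputableFun g) : ∃ φ : ℕ × ℕ → Cantor → ℝ≥0, UniformlyStep φ ∧
      ∀ n X, (g n X : ℝ≥0∞) = ⨆ e, (φ (n, e) X : ℝ≥0∞) := by
  obtain ⟨ψ, hψ, hle, hge⟩ := hg.exists_step_le
  refine ⟨fun p => ψ (p.1, (Denumerable.eqv _).symm p.2),
    hψ.comp (Computable.fst.pair ((Computable.ofNat _).comp Computable.snd)), fun n X => ?_⟩
  rw [(Denumerable.eqv (ℕ × ℕ × ℕ)).symm.iSup_comp (g := fun e => (ψ (n, e) X : ℝ≥0∞))]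
  refine le_antisymm (le_of_forall_le_add_two_div_two_pow fun k => ?_)
    (iSup_le fun e => ENNReal.coe_le_coe.2 (hle n e X))
  obtain ⟨e, he⟩ := hge n k X
  calc (g n X : ℝ≥0∞)
    _ ≤ (ψ (n, e) X + 2 / 2 ^ k : ℝ≥0) := ENNReal.coe_le_coe.2 he
    _ = ψ (n, e) X + 2 / 2 ^ k := by
      rw [ENNReal.coe_add, ennreal_coe_two_div_two_pow]
    _ ≤ (⨆ e, (ψ (n, e) X : ℝ≥0∞)) + 2 / 2 ^ k := by
      gcongr; exact le_iSup (fun e => (ψ (n, e) X : ℝ≥0∞)) e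

theorem iSup_sum_range_eq_tsum_iSup {w : ℕ → ℕ → ℝ≥0∞} (hw : ∀ n, Monotone (w n)) :
    ⨆ m, ∑ n ∈ Finset.range (m + 1), w n m = ∑' n, ⨆ m, w n m := by
  rw [ENNReal.tsum_eq_iSup_nat]
  simp only [ENNReal.finsetSum_iSup_of_monotone hw]
  refine le_antisymm (iSup_le fun m => le_iSup₂_of_le (m + 1) m le_rfl)
    (iSup₂_le fun N m => le_iSup_of_le (max N m) ?_)
  calc ∑ n ∈ Finset.range N, w n m
    _ ≤ ∑ n ∈ Finset.range N, w n (max N m) := Finset.sum_le_sum fun n _ => hw n (le_max_right _ _)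
    _ ≤ ∑ n ∈ Finset.range (max N m + 1), w n (max N m) :=
      Finset.sum_le_sum_of_subset (Finset.range_subset_range.2 (by omega))

theorem UniformlyComputableFun.exists_monotone_iSup {g : ℕ → Cantor → ℝ≥0}
    (hg : UniformlyComputableFun g) : ∃ w : ℕ × ℕ → Cantor → ℝ≥0, UniformlyStep w ∧
      (∀ n X, Monotone fun m => w (n, m) X) ∧
      ∀ n X, (g n X : ℝ≥0∞) = ⨆ m, (w (n, m) X : ℝ≥0∞) := by
  obtain ⟨φ, hφ, hgφ⟩ := hg.exists_iSup
  refine ⟨_, hφ.partialSups, fun n X => (partialSups fun e => φ (n, e) X).monotone, fun n X => ?_⟩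
  have hle (e) : φ (n, e) X ≤ g n X :=
    ENNReal.coe_le_coe.1 (hgφ n X ▸ le_iSup (fun e => (φ (n, e) X : ℝ≥0∞)) e)
  refine le_antisymm ?_ (iSup_le fun m =>
    ENNReal.coe_le_coe.2 (partialSups_le _ _ _ fun e _ => hle e))
  rw [hgφ]
  exact iSup_mono fun e => ENNReal.coe_le_coe.2 (le_partialSups (fun e => φ (n, e) X) e)

theorem LowerSemicomputable.exists_step {t : Cantor → ℝ≥0∞} (ht : LowerSemicomputable t) :
    ∃ u : ℕ → Cantor → ℝ≥0, UniformlyStep u ∧ Monotone u ∧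
      ∀ X, t X = ⨆ m, (u m X : ℝ≥0∞) := by
  obtain ⟨g, hg, htg⟩ := ht
  obtain ⟨w, hw, hwmono, hgw⟩ := hg.exists_monotone_iSup
  refine ⟨fun m X => ∑ n ∈ Finset.range (m + 1), w (n, m) X, hw.diagonalSum,
    fun a b hab X => ?_, fun X => ?_⟩
  · calc ∑ n ∈ Finset.range (a + 1), w (n, a) X
      _ ≤ ∑ n ∈ Finset.range (a + 1), w (n, b) X := Finset.sum_le_sum fun n _ => hwmono n X hab
      _ ≤ ∑ n ∈ Finset.range (b + 1), w (n, b) X :=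
        Finset.sum_le_sum_of_subset (Finset.range_subset_range.2 (by omega))
  · simp only [htg, hgw, ENNReal.ofNNReal_finsetSum]
    exact (iSup_sum_range_eq_tsum_iSup fun n a b h => ENNReal.coe_le_coe.2 (hwmono n X h)).symm

theorem UniformlyComputableNNReal.exists_modulus {x : ℕ → ℝ≥0} {I : ℝ≥0}
    (hx : UniformlyComputableNNReal x) (hmono : Monotone x) (hlim : Tendsto x atTop (𝓝 I))
    (hI : ComputableNNReal I) :
    ∃ M : ℕ → ℕ, Computable M ∧ StrictMono M ∧ ∀ k, I ≤ x (M k) + (2 ^ k)⁻¹ := by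
  obtain ⟨r, hr, hxr⟩ := hx
  obtain ⟨q, hq, hIq⟩ := hI
  have hrk : Computable fun p : ℕ × ℕ => r p.2 (p.1 + 2) := hr.comp (by fun_prop) (by fun_prop)
  have hsearch (k) : ∃ m, decide (q (k + 2) ≤ r m (k + 2) + 2) = true := by
    obtain ⟨m, hm⟩ : ∃ m, I < x m + (2 ^ (k + 2))⁻¹ :=
      ((hlim.add_const _).eventually_const_lt (lt_add_of_pos_right I (by positivity))).exists
    refine ⟨m, decide_eq_true (Nat.lt_succ_iff.1 ?_)⟩
    rw [← Nat.cast_lt (α := ℝ≥0)]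
    calc (q (k + 2) : ℝ≥0)
      _ ≤ I * 2 ^ (k + 2) + 1 := (dyadicApprox_iff.1 (hIq _)).2
      _ < (x m + (2 ^ (k + 2))⁻¹) * 2 ^ (k + 2) + 1 := by gcongr
      _ = x m * 2 ^ (k + 2) + 2 := by
        rw [add_mul, inv_mul_cancel₀ (by positivity), add_assoc, one_add_one_eq_two]
      _ ≤ (r m (k + 2) + 1) + 2 := by gcongr; exact (dyadicApprox_iff.1 (hxr _ _)).1
      _ = ((r m (k + 2) + 2).succ : ℕ) := by push_cast; ring
  obtain ⟨m, hm, hmspec⟩ := exists_computable_search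
    (p := fun p => decide (q (p.1 + 2) ≤ r p.2 (p.1 + 2) + 2))
    (computable_decide_le (by fun_prop) (computable_nat_add hrk (.const 2))) hsearch
  have hbound (k) : I ≤ x (m k) + (2 ^ k)⁻¹ := by
    refine le_of_mul_le_mul_right ?_ (show (0 : ℝ≥0) < 2 ^ (k + 2) by positivity)
    calc I * 2 ^ (k + 2)
      _ ≤ q (k + 2) + 1 := (dyadicApprox_iff.1 (hIq _)).1
      _ ≤ r (m k) (k + 2) + 2 + 1 := by
        gcongr; exact_mod_cast of_decide_eq_true (hmspec k)
      _ ≤ x (m k) * 2 ^ (k + 2) + 1 + 2 + 1 := by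
        gcongr; exact (dyadicApprox_iff.1 (hxr _ _)).2
      _ = (x (m k) + (2 ^ k)⁻¹) * 2 ^ (k + 2) := by field_simp; ring
  obtain ⟨M, hM, hMmono, hle⟩ := exists_computable_strictMono_ge hm
  exact ⟨M, hM, hMmono, fun k => (hbound k).trans (by gcongr; exact hmono (hle k))⟩

theorem UniformlyStep.exists_uniformlyComputableNNReal_lintegral {u : ℕ → Cantor → ℝ≥0}
    (hu : UniformlyStep u) :
    ∃ x, UniformlyComputableNNReal x ∧ ∀ m, ∫⁻ X, u m X ∂coin = (x m : ℝ≥0∞) := by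
  obtain ⟨c, D, hc, hD, h⟩ := hu.exists_lintegral_eq
  exact ⟨_, .of_approx (hc.comp Computable.fst) (hD.comp Computable.fst) fun m k => by simp, h⟩

theorem LowerSemicomputable.exists_fast_approximation {t : Cantor → ℝ≥0∞}
    (ht : LowerSemicomputable t) {I : ℝ≥0} (hI : ComputableNNReal I)
    (htI : ∫⁻ X, t X ∂coin = I) :
    ∃ s : ℕ → Cantor → ℝ≥0, UniformlyStep s ∧ Monotone s ∧
      (∀ X, t X = ⨆ k, (s k X : ℝ≥0∞)) ∧
      ∀ k, ∫⁻ X, t X ∂coin ≤ ∫⁻ X, s k X ∂coin + (4 ^ k)⁻¹ := by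
  obtain ⟨u, hu, humono, htu⟩ := ht.exists_step
  obtain ⟨x, hx, hux⟩ := hu.exists_uniformlyComputableNNReal_lintegral
  have hcoe (X) : Monotone fun m => (u m X : ℝ≥0∞) := fun a b hab =>
    ENNReal.coe_le_coe.2 (humono hab X)
  have hxmono : Monotone x := fun a b hab => by
    rw [← ENNReal.coe_le_coe, ← hux, ← hux]
    exact lintegral_mono fun X => hcoe X hab
  have hlim : Tendsto x atTop (𝓝 I) := by
    rw [← ENNReal.tendsto_coe, ← htI]
    simp only [← hux, htu]
    exact lintegral_tendsto_of_tendsto_of_monotone (fun m => (hu.measurable m).aemeasurable)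
      (.of_forall hcoe) (.of_forall fun X => tendsto_atTop_iSup (hcoe X))
  obtain ⟨M, hM, hMmono, hle⟩ := hx.exists_modulus hxmono hlim hI
  refine ⟨fun k => u (M (2 * k)), hu.comp (by fun_prop),
    fun a b hab => humono (hMmono.monotone (by omega)), fun X => ?_, fun k => ?_⟩
  · have htwo : StrictMono fun k => M (2 * k) := hMmono.comp fun a b h => by omega
    rw [htu, (hcoe X).iSup_comp_tendsto_atTop htwo.tendsto_atTop]
  · have hfour : ((4 : ℝ≥0∞) ^ k)⁻¹ = (2 ^ (2 * k))⁻¹ := by rw [pow_mul]; norm_num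
    rw [htI, hux, hfour, ← ennreal_coe_inv_two_pow, ← ENNReal.coe_add]
    exact ENNReal.coe_le_coe.2 (hle (2 * k))

end Approximation

section Jumps

theorem measure_setOf_add_le_le {Ω : Type*} [MeasurableSpace Ω] {μ : Measure Ω}
    {f g : Ω → ℝ≥0∞} (hg : Measurable g) (hfin : ∫⁻ x, f x ∂μ ≠ ∞) (hle : f ≤ g) {ε δ : ℝ≥0∞}
    (hε : ε ≠ 0) (hε' : ε ≠ ∞) (h : ∫⁻ x, g x ∂μ ≤ ∫⁻ x, f x ∂μ + ε * δ) :
    μ {x | f x + ε ≤ g x} ≤ δ := by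
  have := (lintegral_add_mul_meas_add_le_le_lintegral (.of_forall hle) hg.aemeasurable ε).trans h
  exact (ENNReal.mul_le_mul_iff_right hε hε').1 ((ENNReal.add_le_add_iff_left hfin).1 this)

/-- The points at which the approximation `s` grows by more than `2 ^ (-k)` from stage `k` to
stage `k + 1`. -/
def jumpSet (s : ℕ → Cantor → ℝ≥0) (k : ℕ) : Set Cantor := {X | s k X + (2 ^ k)⁻¹ < s (k + 1) X}

variable {s : ℕ → Cantor → ℝ≥0}

theorem uniformlyClopen_jumpSet (hs : UniformlyStep s) : UniformlyClopen (jumpSet s) := by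
  have hpow : UniformlyStep fun (k : ℕ) (_ : Cantor) => ((2 : ℝ≥0) ^ k)⁻¹ := by
    simpa using UniformlyStep.const (.const 1) .id
  exact (hs.add hpow).uniformlyClopen_lt (hs.comp (g := fun k => k + 1) (by fun_prop))

theorem coin_jumpSet_le (hs : UniformlyStep s) (hmono : Monotone s) {k : ℕ}
    (h : ∫⁻ X, s (k + 1) X ∂coin ≤ ∫⁻ X, s k X ∂coin + (4 ^ k)⁻¹)
    (hfin : ∫⁻ X, s k X ∂coin ≠ ∞) : coin (jumpSet s k) ≤ (2 ^ k)⁻¹ := by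
  have hsub : jumpSet s k ⊆ {X | (s k X : ℝ≥0∞) + (2 ^ k)⁻¹ ≤ s (k + 1) X} := fun X hX => by
    rw [Set.mem_ofPred_eq, ← ennreal_coe_inv_two_pow, ← ENNReal.coe_add]
    exact ENNReal.coe_le_coe.2 (le_of_lt hX)
  refine (measure_mono hsub).trans (measure_setOf_add_le_le (hs.measurable (k + 1)) hfin
    (fun X => ENNReal.coe_le_coe.2 (hmono k.le_succ X)) (by simp) (by simp) (h.trans_eq ?_))
  rw [← ENNReal.mul_inv (by simp) (by simp), ← mul_pow, show (2 * 2 : ℝ≥0∞) = 4 by norm_num]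

end Jumps

section TailInf

/-- The infimum of `a k + 2 * 2 ^ (-k)` over `k ≥ n`. For increasing `a` it is at most the limit
of `a`, with equality as soon as no increment `a (k + 1) - a k` with `k ≥ n` exceeds `2 ^ (-k)`. -/
noncomputable def tailInf (a : ℕ → ℝ≥0) (n : ℕ) : ℝ≥0 := ⨅ j, a (n + j) + 2 / 2 ^ (n + j)

variable {a : ℕ → ℝ≥0}

theorem tailInf_le (a : ℕ → ℝ≥0) (n j : ℕ) : tailInf a n ≤ a (n + j) + 2 / 2 ^ (n + j) :=
  ciInf_le (OrderBot.bddBelow _) j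

theorem tailInf_le_iSup (a : ℕ → ℝ≥0) (n : ℕ) : (tailInf a n : ℝ≥0∞) ≤ ⨆ k, (a k : ℝ≥0∞) := by
  refine le_of_forall_le_add_two_div_two_pow fun j => ?_
  calc (tailInf a n : ℝ≥0∞)
    _ ≤ a (n + j) + 2 / 2 ^ (n + j) := by
      rw [← ennreal_coe_two_div_two_pow, ← ENNReal.coe_add]
      exact ENNReal.coe_le_coe.2 (tailInf_le a n j)
    _ ≤ (⨆ k, (a k : ℝ≥0∞)) + 2 / 2 ^ j := by
      gcongr
      · exact le_iSup (fun k => (a k : ℝ≥0∞)) _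
      · exact one_le_two
      · omega

theorem tailInf_eq_iSup (ha : Monotone a) {n : ℕ} (h : ∀ k ≥ n, a (k + 1) ≤ a k + (2 ^ k)⁻¹) :
    tailInf a n = ⨆ k, (a k : ℝ≥0∞) := by
  have hanti : Antitone fun j => a (n + j) + 2 / 2 ^ (n + j) := antitone_nat_of_succ_le fun j =>
    calc a (n + j + 1) + 2 / 2 ^ (n + j + 1)
      _ ≤ a (n + j) + (2 ^ (n + j))⁻¹ + 2 / 2 ^ (n + j + 1) := by
        gcongr; exact h _ (Nat.le_add_right n j)
      _ = a (n + j) + 2 / 2 ^ (n + j) := by rw [pow_succ]; field_simp; ring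
  refine (tailInf_le_iSup a n).antisymm
    (iSup_le fun m => ENNReal.coe_le_coe.2 (le_ciInf fun j => ?_))
  calc a m
    _ ≤ a (n + (j + m)) := ha (by omega)
    _ ≤ a (n + (j + m)) + 2 / 2 ^ (n + (j + m)) := le_self_add
    _ ≤ a (n + j) + 2 / 2 ^ (n + j) := hanti (Nat.le_add_right j m)

theorem inf'_le_tailInf_add (ha : Monotone a) (n p : ℕ) :
    ((Finset.range (p + 1)).inf' Finset.nonempty_range_add_one fun j => a (n + j) + 2 / 2 ^ (n + j))
      ≤ tailInf a n + 2 / 2 ^ (n + p) := by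
  rw [← tsub_le_iff_right]
  refine le_ciInf fun j => tsub_le_iff_right.2 ?_
  rcases le_or_gt j p with hj | hj
  · exact (Finset.inf'_le _ (Finset.mem_range_succ_iff.2 hj)).trans le_self_add
  · refine (Finset.inf'_le _ (Finset.self_mem_range_succ p)).trans ?_
    gcongr
    exact (ha (by omega)).trans le_self_add

theorem uniformlyComputableFun_tailInf {s : ℕ → Cantor → ℝ≥0} (hs : UniformlyStep s)
    (hmono : Monotone s) : UniformlyComputableFun fun n X => tailInf (s · X) n := by
  have hpow : UniformlyStep fun (p : ℕ × ℕ) (_ : Cantor) => (2 / 2 ^ (p.1 + p.2) : ℝ≥0) := by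
    exact_mod_cast UniformlyStep.const (c := fun _ => 2) (D := fun p : ℕ × ℕ => p.1 + p.2)
      (.const 2) (by fun_prop)
  have hshift : UniformlyStep fun p : ℕ × ℕ => s (p.1 + p.2) := hs.comp (by fun_prop)
  have hinf := (hshift.add hpow).inf'.comp (g := fun p : ℕ × ℕ => (p.1, p.2 + 2)) (by fun_prop)
  refine .of_step hinf fun n k X => ?_
  have hprec : (2 / 2 ^ (n + (k + 2)) : ℝ≥0) ≤ (2 ^ (k + 1))⁻¹ :=
    calc (2 / 2 ^ (n + (k + 2)) : ℝ≥0)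
      _ ≤ 2 / 2 ^ (k + 2) := by
        gcongr (2 / 2 ^ ?_)
        · exact one_le_two
        · exact Nat.le_add_left _ _
      _ = (2 ^ (k + 1))⁻¹ := by rw [pow_succ _ (k + 1)]; field_simp
  have happrox := abs_coe_sub_coe_le (Finset.le_inf' _ _ fun j _ => tailInf_le (s · X) n j)
    ((inf'_le_tailInf_add (fun i j h => hmono h X) n (k + 2)).trans (add_le_add le_rfl hprec))
  rw [abs_sub_comm]
  exact happrox.trans_eq (by push_cast; rfl)

end TailInf

end Schnorr

theorem lemma2p6 (t : Schnorr.Cantor → ℝ≥0∞) (ht : Schnorr.LowerSemicomputable t)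
    (I : ℝ≥0) (hI : Schnorr.ComputableNNReal I) (htI : ∫⁻ X, t X ∂Schnorr.coin = (I : ℝ≥0∞)) :
    ∃ h : ℕ → Schnorr.Cantor → ℝ≥0, Schnorr.UniformlyComputableFun h ∧
      (∀ n X, (h n X : ℝ≥0∞) ≤ t X) ∧
      ∀ A, Schnorr.SchnorrRandom A → ∃ n, (h n A : ℝ≥0∞) = t A := by
  obtain ⟨s, hs, hmono, hts, hfast⟩ := ht.exists_fast_approximation hI htI
  have hst (k : ℕ) : ∫⁻ X, s k X ∂Schnorr.coin ≤ ∫⁻ X, t X ∂Schnorr.coin :=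
    lintegral_mono fun X => (hts X).symm ▸ le_iSup (fun k => (s k X : ℝ≥0∞)) k
  have hfin (k : ℕ) : ∫⁻ X, s k X ∂Schnorr.coin ≠ ∞ :=
    ne_top_of_le_ne_top (htI ▸ ENNReal.coe_ne_top) (hst k)
  refine ⟨fun n X => Schnorr.tailInf (s · X) n, Schnorr.uniformlyComputableFun_tailInf hs hmono,
    fun n X => (hts X).symm ▸ Schnorr.tailInf_le_iSup _ n, fun A hA => ?_⟩
  obtain ⟨n, hn⟩ := hA.eventually_notMem (Schnorr.uniformlyClopen_jumpSet hs) fun k =>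
    Schnorr.coin_jumpSet_le hs hmono ((hst (k + 1)).trans (hfast k)) (hfin k)
  refine ⟨n, ?_⟩
  rw [hts]
  exact Schnorr.tailInf_eq_iSup (fun i j h => hmono h A) fun k hk => not_lt.1 (hn k hk)
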